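/- There is an absolute constant $c>0$ such that the following holds. Let $k\ge 1$ be an integer, let $\varepsilon\in(0,1/4]$, let $\mathcal Y$ be a countable (finite or countably infinite) message space, and let $\mathcal W$ be any family of channels $W\colon[2k]\to\mathcal Y$, where $W(y\mid x)$ is the probability of output $y\in\mathcal Y$ on input $x\in[2k]=\{1,\dots,2k\}$. For $W\in\mathcal W$ let $H(W)$ be the $k\times k$ matrix $$H(W)_{i,j}=\sum_{y\in\mathcal Y}\frac{\big(W(y\mid 2i-1)-W(y\mid 2i)\big)\big(W(y\mid 2j-1)-W(y\mid 2j)\big)}{\sum_{x\in[2k]}W(y\mid x)}$$ (with $0/0=0$), and put $\|\mathcal W\|_{op}=\sup_{W\in\mathcal W}\|H(W)\|_{op}$ and $\|\mathcal W\|_{\ast}=\sup_{W\in\mathcal W}\|H(W)\|_{\ast}$, the suprema of the (Euclidean) operator norms and of the nuclear norms (both $0$ if $\mathcal W$ is empty). In an interactive protocol with $n$ users using $\mathcal W$, the users hold independent samples $X_1,\dots,X_n$ from an unknown distribution $p$ on $[2k]$; there is public randomness $U$, of any law, independent of the samples; for $t=1,\dots,n$, user $t$ selects a channel $W_t\in\mathcal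 W$ as a function of $(Y_1,\dots,Y_{t-1},U)$ and sends the message $Y_t$, which equals $y$ with probability $W_t(y\mid X_t)$. Such a protocol together with a randomized decision $T(Y_1,\dots,Y_n,U)\in\{0,1\}$ is an $(n,\varepsilon)$-test for uniformity if $\Pr[T=0]\ge 99/100$ when $p$ is the uniform distribution $\mathbf u$ on $[2k]$, and $\Pr[T=1]\ge 99/100$ for every $p$ with $d_{TV}(p,\mathbf u)=\sup_{S\subseteq[2k]}(p(S)-\mathbf u(S))\ge\varepsilon$. The sample complexity of interactive $(2k,\varepsilon)$-uniformity testing using $\mathcal W$ is the least $n$ for which such a test exists ($+\infty$ if there is none). Then the sample complexity of interactive $(2k,\varepsilon)$-uniformity testing using $\mathcal W$ is at least $$c\cdot\frac{k}{\varepsilon^2\sqrt{\|\mathcal W\|_{op}\,\|\mathcal W\|_{\ast}}},$$ where the bound is read as $+\infty$ if $\|\mathcal W\|_{op}\,\|\mathcal W\|_{\ast}=0$ (that is, no test exists in that case). -/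

import Mathlib

open scoped ENNReal

universe u v

noncomputable section

namespace InteractiveTesting

/-- A channel from the domain `[2k]` to the message space `Y`:
`W x y` is the probability `W(y ∣ x)` that the output is `y` on input `x`. -/
abbrev Channel (k : ℕ) (Y : Type u) : Type u := Fin (2 * k) → PMF Y

/-- The element `2i - 1` of `[2k] = {1, …, 2k}` for `i ∈ [k]`
(with both sets numbered from zero: the element `2i`). -/
def oddElem {k : ℕ} (i : Fin k) : Fin (2 * k) := ⟨2 * i, by omega⟩

/-- The element `2i` of `[2k] = {1, …, 2k}` for `i ∈ [k]`
(with both sets numbered from zero: the element `2i + 1`). -/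
def evenElem {k : ℕ} (i : Fin k) : Fin (2 * k) := ⟨2 * i + 1, by omega⟩

/-- The channel information matrix `H(W)`. Messages `y` that have probability zero for every input
contribute `0 / 0 = 0`. The sum over `y` is always absolutely convergent. -/
def infoMatrix {k : ℕ} {Y : Type u} (W : Channel k Y) : Matrix (Fin k) (Fin k) ℝ :=
  Matrix.of fun i j =>
    ∑' y : Y,
      ((W (oddElem i) y).toReal - (W (evenElem i) y).toReal) *
          ((W (oddElem j) y).toReal - (W (evenElem j) y).toReal) /
        ∑ x : Fin (2 * k), (W x y).toReal

/-- The operator norm of a square real matrix with respect to the Euclidean norm. -/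
def opNorm {k : ℕ} (A : Matrix (Fin k) (Fin k) ℝ) : ℝ :=
  ‖Matrix.toEuclideanCLM (n := Fin k) (𝕜 := ℝ) A‖

/-- The nuclear norm of a square real matrix: the sum of its singular values. -/
def nuclearNorm {k : ℕ} (A : Matrix (Fin k) (Fin k) ℝ) : ℝ :=
  ∑ i : Fin k, (Matrix.toEuclideanLin A).singularValues i

/-- `‖𝒲‖_op`, the maximum operator norm of `H(W)` over `W ∈ 𝒲`. -/
def familyOpNorm {k : ℕ} {Y : Type u} (𝒲 : Set (Channel k Y)) : ℝ≥0∞ :=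
  ⨆ W ∈ 𝒲, ENNReal.ofReal (opNorm (infoMatrix W))

/-- `‖𝒲‖_*`, the maximum nuclear norm of `H(W)` over `W ∈ 𝒲`. -/
def familyNuclearNorm {k : ℕ} {Y : Type u} (𝒲 : Set (Channel k Y)) : ℝ≥0∞ :=
  ⨆ W ∈ 𝒲, ENNReal.ofReal (nuclearNorm (infoMatrix W))

/-- Total variation distance between distributions on a finite set: `sup_S (p(S) - q(S))`. -/
def tvDist {X : Type*} [Fintype X] (p q : PMF X) : ℝ :=
  ⨆ S : Finset X, (∑ x ∈ S, (p x).toReal - ∑ x ∈ S, (q x).toReal)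

/-- A sequentially interactive protocol for `n` users with channels in `𝒲` and public
randomness in `Ω`: user `t` selects its channel in `𝒲` as a function of the messages of the users
before it and of the public randomness. -/
structure Protocol {k : ℕ} {Y : Type u} (𝒲 : Set (Channel k Y)) (n : ℕ)
    (Ω : Type v) [MeasurableSpace Ω] where
  /-- The channel of user `t`, given the previous messages and the public randomness. -/
  chan : (t : Fin n) → (Fin t → Y) → Ω → Channel k Y
  chan_mem : ∀ t past ω, chan t past ω ∈ 𝒲
  measurable_chan : ∀ t past x y, Measurable fun ω => chan t past ω x y

/-- The law of the first `t` messages when the public randomness equals `ω` and every user holds an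
independent sample of `p`: user number `t` (counted from zero) draws `x` from `p` and sends
`y` with probability `W(y ∣ x)`, where `W` is the channel selected from the past messages
and `ω`. -/
def Protocol.messageLaw {k : ℕ} {Y : Type u} {𝒲 : Set (Channel k Y)} {n : ℕ}
    {Ω : Type v} [MeasurableSpace Ω] (P : Protocol 𝒲 n Ω) (p : PMF (Fin (2 * k))) (ω : Ω) :
    (t : ℕ) → t ≤ n → PMF (Fin t → Y)
  | 0, _ => PMF.pure Fin.elim0
  | t + 1, h =>
      (P.messageLaw p ω t (Nat.le_of_succ_le h)).bind fun past =>
        p.bind fun x =>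
          (P.chan ⟨t, h⟩ past ω x).bind fun y =>
            PMF.pure (Fin.snoc (α := fun _ => Y) past y)

/-- A randomized decision function of the transcript: given the messages and the public
randomness, it outputs `false` (that is `0`, accept) or `true` (that is `1`, reject). -/
structure Decision (Y : Type u) (n : ℕ) (Ω : Type v) [MeasurableSpace Ω] where
  /-- The law of the output, given the messages and the public randomness. -/
  out : (Fin n → Y) → Ω → PMF Bool
  measurable_out : ∀ y b, Measurable fun ω => out y ω b

/-- The probability that the decision is `b` when the samples are independent with law `p` and
the public randomness, independent of the samples, has law `μ`. -/
def decisionProb {k : ℕ} {Y : Type u} {𝒲 : Set (Channel k Y)} {n : ℕ}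
    {Ω : Type v} [MeasurableSpace Ω] (μ : MeasureTheory.Measure Ω)
    (P : Protocol 𝒲 n Ω) (T : Decision Y n Ω) (p : PMF (Fin (2 * k))) (b : Bool) : ℝ≥0∞ :=
  ∫⁻ ω, ((P.messageLaw p ω n le_rfl).bind fun y => T.out y ω) b ∂μ

/-- The uniform distribution on `[2k]`. -/
def uniformDist (k : ℕ) [NeZero k] : PMF (Fin (2 * k)) :=
  PMF.uniformOfFintype (Fin (2 * k))

/-- `(P, T)` with public randomness of law `μ` is an `(n, ε)`-test for the reference
distribution `q` on `[2k]`. -/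
def IsIdentityTest {k : ℕ} {Y : Type u} {𝒲 : Set (Channel k Y)} {n : ℕ}
    {Ω : Type v} [MeasurableSpace Ω] (q : PMF (Fin (2 * k))) (ε : ℝ)
    (μ : MeasureTheory.Measure Ω) (P : Protocol 𝒲 n Ω) (T : Decision Y n Ω) : Prop :=
  99 / 100 ≤ decisionProb μ P T q false ∧
    ∀ p : PMF (Fin (2 * k)), ε ≤ tvDist p q → 99 / 100 ≤ decisionProb μ P T p true

/-- There is an interactive `(n, ε)`-test for uniformity over `[2k]` using `𝒲`. -/
def ExistsUniformityTest {k : ℕ} [NeZero k] {Y : Type u} (𝒲 : Set (Channel k Y)) (ε : ℝ)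
    (n : ℕ) : Prop :=
  ∃ (Ω : Type v) (_ : MeasurableSpace Ω) (μ : MeasureTheory.Measure Ω)
    (_ : MeasureTheory.IsProbabilityMeasure μ) (P : Protocol 𝒲 n Ω) (T : Decision Y n Ω),
    IsIdentityTest (uniformDist k) ε μ P T

/-- The sample complexity of interactive `(2k, ε)`-uniformity testing using `𝒲`: the least number
of users for which a test exists, and `⊤` if there is none. -/
def sampleComplexity {k : ℕ} [NeZero k] {Y : Type u} (𝒲 : Set (Channel k Y)) (ε : ℝ) : ℕ∞ :=
  ⨅ (n : ℕ) (_ : ExistsUniformityTest.{u, v} 𝒲 ε n), (n : ℕ∞)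

end InteractiveTesting

end

/-! The method is Le Cam's, with a mixture. Put `δ = 2ε` and, for each sign vector `z`, move mass `δ
/ (2k)` within every pair `{2i - 1, 2i}` in the direction `z i`. Each such distribution is `ε`-far
from uniform, so a test must tell the average over `z` of the transcript laws from the transcript
law under uniform samples.

With one message from `W`, the likelihood ratio against uniform is `1 + δ ∑ z_i s_i`, where the
scores `s_i` are centred with covariance `H(W) / (2k)`. Given the past, the mixture's ratio has the
same form with `z` replaced by its posterior mean `c`. Hence one message raises the divergence `E[M
log M]` of the mixture ratio `M` by at most `δ² / (2k) · E[M cᵀ H c] ≤ δ² ‖𝒲‖_op / (2k) · E[M |c|²]`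
(`expect_mixture_mul_log_snoc_le`).

An adaptive choice of channels helps only as far as the past reveals `z`. By symmetrization `M |c|²`
is at most the sum over `i` of the averaged squared Hellinger distances between the laws for `z` and
for `z` with sign `i` flipped (`mixture_mul_sum_posterior_sq_le`). Each message adds at most `(2δ² /
k) tr H ≤ (2δ² / k) ‖𝒲‖_*` to its expectation (`expect_hellinger_snoc_le`). Summing over users
bounds the divergence by `δ⁴ ‖𝒲‖_op ‖𝒲‖_* n² / k²`. A convexity inequality (`expect_mixture_mul_le`)
shows that a test forces the divergence above a constant.

Everything is proved for a fixed value of the public randomness and then integrated. -/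

noncomputable section

namespace InteractiveTesting

/-! ### Bounded real functions -/

/-- A real-valued function that is bounded in absolute value. -/
def IsBdd {α : Type*} (h : α → ℝ) : Prop := ∃ C, ∀ a, |h a| ≤ C

namespace IsBdd

variable {α : Type*} {f g : α → ℝ}

theorem const (c : ℝ) : IsBdd fun _ : α => c := ⟨|c|, fun _ => le_rfl⟩

theorem add (hf : IsBdd f) (hg : IsBdd g) : IsBdd fun a => f a + g a := by
  obtain ⟨C, hC⟩ := hf
  obtain ⟨D, hD⟩ := hg
  exact ⟨C + D, fun a => (abs_add_le _ _).trans (add_le_add (hC a) (hD a))⟩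

theorem mul (hf : IsBdd f) (hg : IsBdd g) : IsBdd fun a => f a * g a := by
  obtain ⟨C, hC⟩ := hf
  obtain ⟨D, hD⟩ := hg
  refine ⟨C * D, fun a => ?_⟩
  rw [abs_mul]
  exact mul_le_mul (hC a) (hD a) (abs_nonneg _) ((abs_nonneg _).trans (hC a))

theorem sub (hf : IsBdd f) (hg : IsBdd g) : IsBdd fun a => f a - g a := by
  simpa [sub_eq_add_neg] using hf.add ((const (-1)).mul hg)

theorem pow (hf : IsBdd f) (n : ℕ) : IsBdd fun a => f a ^ n := by
  obtain ⟨C, hC⟩ := hf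
  exact ⟨C ^ n, fun a => by rw [abs_pow]; exact pow_le_pow_left₀ (abs_nonneg _) (hC a) n⟩

theorem sum {ι : Type*} (s : Finset ι) {f : ι → α → ℝ} (hf : ∀ i ∈ s, IsBdd (f i)) :
    IsBdd fun a => ∑ i ∈ s, f i a := by
  classical
  induction s using Finset.induction_on with
  | empty => simpa using const 0
  | insert i s hi ih =>
    simp only [Finset.sum_insert hi]
    exact (hf i (by simp)).add (ih fun j hj => hf j (by simp [hj]))

theorem comp {β : Type*} (hf : IsBdd f) (φ : β → α) : IsBdd fun b => f (φ b) :=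
  hf.imp fun _ h b => h (φ b)

theorem of_abs_le (hg : IsBdd g) (h : ∀ a, |f a| ≤ g a) : IsBdd f := by
  obtain ⟨C, hC⟩ := hg
  exact ⟨C, fun a => (h a).trans ((le_abs_self _).trans (hC a))⟩

theorem sqrt (hf : IsBdd f) : IsBdd fun a => √(f a) := by
  obtain ⟨C, hC⟩ := hf
  refine ⟨√C, fun a => ?_⟩
  rw [abs_of_nonneg (Real.sqrt_nonneg _)]
  exact Real.sqrt_le_sqrt ((le_abs_self _).trans (hC a))

theorem log (hf : IsBdd f) (hf' : IsBdd fun a => (f a)⁻¹) (h0 : ∀ a, 0 < f a) :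
    IsBdd fun a => Real.log (f a) := by
  refine (hf.add hf').of_abs_le fun a => ?_
  have h1 := Real.log_le_sub_one_of_pos (h0 a)
  have h2 := Real.log_le_sub_one_of_pos (inv_pos.2 (h0 a))
  rw [Real.log_inv] at h2
  have := h0 a
  have := inv_pos.2 (h0 a)
  exact abs_le.2 ⟨by linarith, by linarith⟩

end IsBdd

/-! ### Expectations of bounded functions under discrete distributions -/

/-- The expectation of `h` under the discrete distribution `p`. -/
def expect {α : Type*} (p : PMF α) (h : α → ℝ) : ℝ := ∑' a, (p a).toReal * h a

section Expect

variable {α β : Type*} (p : PMF α)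

theorem summable_toReal : Summable fun a => (p a).toReal :=
  ENNReal.summable_toReal p.tsum_coe_ne_top

theorem tsum_toReal : ∑' a, (p a).toReal = 1 := by
  rw [← ENNReal.tsum_toReal_eq fun a => p.apply_ne_top a, p.tsum_coe, ENNReal.toReal_one]

variable {p}

theorem summable_expect {h : α → ℝ} (hh : IsBdd h) : Summable fun a => (p a).toReal * h a := by
  obtain ⟨C, hC⟩ := hh
  refine Summable.of_norm_bounded ((summable_toReal p).mul_right C) fun a => ?_
  rw [Real.norm_eq_abs, abs_mul, abs_of_nonneg ENNReal.toReal_nonneg]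
  exact mul_le_mul_of_nonneg_left (hC a) ENNReal.toReal_nonneg

theorem expect_const (c : ℝ) : expect p (fun _ => c) = c := by
  rw [expect, tsum_mul_right, tsum_toReal, one_mul]

theorem expect_add {f g : α → ℝ} (hf : IsBdd f) (hg : IsBdd g) :
    expect p (fun a => f a + g a) = expect p f + expect p g := by
  simp only [expect, mul_add]
  exact (summable_expect hf).tsum_add (summable_expect hg)

theorem expect_sub {f g : α → ℝ} (hf : IsBdd f) (hg : IsBdd g) :
    expect p (fun a => f a - g a) = expect p f - expect p g := by
  simp only [expect, mul_sub]
  exact (summable_expect hf).tsum_sub (summable_expect hg)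

theorem expect_const_mul (c : ℝ) (f : α → ℝ) :
    expect p (fun a => c * f a) = c * expect p f := by
  simp only [expect, mul_left_comm _ c]
  exact tsum_mul_left

theorem expect_sum {ι : Type*} (s : Finset ι) {f : ι → α → ℝ} (hf : ∀ i ∈ s, IsBdd (f i)) :
    expect p (fun a => ∑ i ∈ s, f i a) = ∑ i ∈ s, expect p (f i) := by
  simp only [expect, Finset.mul_sum]
  exact Summable.tsum_finsetSum fun i hi => summable_expect (hf i hi)

theorem expect_mono {f g : α → ℝ} (hf : IsBdd f) (hg : IsBdd g) (h : ∀ a, f a ≤ g a) :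
    expect p f ≤ expect p g :=
  (summable_expect hf).tsum_le_tsum
    (fun a => mul_le_mul_of_nonneg_left (h a) ENNReal.toReal_nonneg) (summable_expect hg)

theorem IsBdd.expect {κ : α → PMF β} {f : α → β → ℝ} {C : ℝ} (hf : ∀ a b, |f a b| ≤ C) :
    IsBdd fun a => expect (κ a) (f a) := by
  refine ⟨C, fun a => ?_⟩
  have hb : IsBdd (f a) := ⟨C, hf a⟩
  refine abs_le.2 ⟨?_, ?_⟩
  · rw [← expect_const (p := κ a) (-C)]
    exact expect_mono (IsBdd.const _) hb fun b => (abs_le.1 (hf a b)).1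
  · rw [← expect_const (p := κ a) C]
    exact expect_mono hb (IsBdd.const _) fun b => (abs_le.1 (hf a b)).2

theorem expect_pure (a : α) (h : α → ℝ) : expect (PMF.pure a) h = h a := by
  classical
  rw [expect, tsum_eq_single a]
  · simp
  · intro b hb
    simp [hb]

theorem toReal_bind_apply (f : α → PMF β) (b : β) :
    (p.bind f b).toReal = ∑' a, (p a).toReal * (f a b).toReal := by
  rw [PMF.bind_apply, ENNReal.tsum_toReal_eq
    fun a => ENNReal.mul_ne_top (p.apply_ne_top a) ((f a).apply_ne_top b)]
  simp only [ENNReal.toReal_mul]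

theorem expect_bind (f : α → PMF β) {h : β → ℝ} (hh : IsBdd h) :
    expect (p.bind f) h = expect p fun a => expect (f a) h := by
  obtain ⟨C, hC⟩ := hh
  have hs : Summable fun x : α × β => (p x.1).toReal * ((f x.1 x.2).toReal * h x.2) := by
    have h1 : Summable fun x : α × β => (p x.1).toReal * ((f x.1 x.2).toReal * C) := by
      -- The bound `C` is known to be nonnegative only once `β` has an element.
      rcases isEmpty_or_nonempty β with hβ | ⟨⟨b⟩⟩
      · have : IsEmpty (α × β) := inferInstance
        exact summable_empty
      have hC0 : 0 ≤ C := (abs_nonneg _).trans (hC b)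
      have h0 : (0 : α × β → ℝ) ≤ fun x => (p x.1).toReal * ((f x.1 x.2).toReal * C) :=
        fun x => mul_nonneg ENNReal.toReal_nonneg (mul_nonneg ENNReal.toReal_nonneg hC0)
      refine (summable_prod_of_nonneg h0).2 ⟨fun a => ?_, ?_⟩
      · have h2 : Summable fun b => (p a).toReal * ((f a b).toReal * C) :=
          ((summable_toReal (f a)).mul_right C).mul_left _
        exact h2
      · simp only [tsum_mul_left, tsum_mul_right, tsum_toReal]
        exact (summable_toReal p).mul_right _
    refine Summable.of_norm_bounded h1 fun x => ?_
    rw [Real.norm_eq_abs, abs_mul, abs_mul, abs_of_nonneg ENNReal.toReal_nonneg,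
      abs_of_nonneg ENNReal.toReal_nonneg]
    gcongr
    exact hC _
  calc expect (p.bind f) h
      = ∑' b, ∑' a, (p a).toReal * ((f a b).toReal * h b) := by
        simp only [expect, toReal_bind_apply, ← tsum_mul_right, mul_assoc]
    _ = ∑' a, ∑' b, (p a).toReal * ((f a b).toReal * h b) := Summable.tsum_comm hs
    _ = _ := by simp only [expect, tsum_mul_left]

end Expect

/-! ### Sums over the domain and the nuclear norm -/

theorem sum_eq_sum_pairs {k : ℕ} {M : Type*} [AddCommMonoid M] (f : Fin (2 * k) → M) :
    ∑ x, f x = ∑ i : Fin k, (f (oddElem i) + f (evenElem i)) := by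
  have h : ∀ i : Fin k, f (oddElem i) + f (evenElem i)
      = ∑ b : Fin 2, f ((finProdFinEquiv (i, b)).cast (Nat.mul_comm k 2)) := by
    intro i
    rw [Fin.sum_univ_two]
    congr 2 <;> ext <;> simp [oddElem, evenElem, finProdFinEquiv, add_comm]
  simp only [h]
  rw [← Fintype.sum_prod_type'
    (f := fun i b => f ((finProdFinEquiv (i, b)).cast (Nat.mul_comm k 2)))]
  exact (Equiv.sum_comp (finProdFinEquiv.trans (finCongr (Nat.mul_comm k 2))) f).symm

/-- In an orthonormal eigenbasis `e` of `T* T`, the trace is `∑ ⟨e i, T (e i)⟩`, and `‖T (e i)‖` is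
the `i`-th singular value; Cauchy–Schwarz compares them term by term. -/
theorem trace_le_nuclearNorm {k : ℕ} (A : Matrix (Fin k) (Fin k) ℝ) :
    A.trace ≤ nuclearNorm A := by
  set T := Matrix.toEuclideanLin A
  have hn : Module.finrank ℝ (EuclideanSpace ℝ (Fin k)) = k := by simp
  set e := T.isSymmetric_adjoint_comp_self.eigenvectorBasis hn
  have htr : A.trace = ∑ i, inner ℝ (e i) (T (e i)) := by
    rw [← LinearMap.trace_eq_sum_inner T e]
    exact (Matrix.trace_toLin_eq A (PiLp.basisFun 2 ℝ (Fin k))).symm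
  rw [htr, nuclearNorm]
  refine Finset.sum_le_sum fun i _ => ?_
  have hi : ‖T (e i)‖ ^ 2 = T.isSymmetric_adjoint_comp_self.eigenvalues hn i := by
    have h2 := T.isSymmetric_adjoint_comp_self.apply_eigenvectorBasis hn i
    rw [← real_inner_self_eq_norm_sq, ← LinearMap.adjoint_inner_right]
    rw [LinearMap.comp_apply] at h2
    erw [h2]
    rw [inner_smul_right, real_inner_self_eq_norm_sq, e.norm_eq_one]
    simp
  rw [T.singularValues_fin hn, ← hi, Real.sqrt_sq (norm_nonneg _)]
  calc inner ℝ (e i) (T (e i)) ≤ ‖e i‖ * ‖T (e i)‖ := real_inner_le_norm _ _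
    _ = _ := by rw [e.norm_eq_one, one_mul]

theorem quadForm_le_opNorm {k : ℕ} (A : Matrix (Fin k) (Fin k) ℝ) (v : Fin k → ℝ) :
    ∑ i, ∑ j, v i * v j * A i j ≤ opNorm A * ∑ i, v i ^ 2 := by
  set w : EuclideanSpace ℝ (Fin k) := WithLp.toLp 2 v
  have h1 : ∑ i, ∑ j, v i * v j * A i j
      = inner ℝ w (Matrix.toEuclideanCLM (n := Fin k) (𝕜 := ℝ) A w) := by
    simp only [PiLp.inner_apply, w, Matrix.toEuclideanCLM_toLp, Matrix.mulVec, dotProduct,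
      RCLike.inner_apply, conj_trivial, Finset.sum_mul]
    exact Finset.sum_congr rfl fun i _ => Finset.sum_congr rfl fun j _ => by ring
  have h2 : ∑ i, v i ^ 2 = ‖w‖ * ‖w‖ := by
    rw [← sq, EuclideanSpace.norm_sq_eq]
    simp [w]
  rw [h1, h2, opNorm]
  calc _ ≤ ‖w‖ * ‖Matrix.toEuclideanCLM (n := Fin k) (𝕜 := ℝ) A w‖ := real_inner_le_norm _ _
    _ ≤ ‖w‖ * (‖Matrix.toEuclideanCLM (n := Fin k) (𝕜 := ℝ) A‖ * ‖w‖) := by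
        gcongr
        exact ContinuousLinearMap.le_opNorm _ _
    _ = _ := by ring

/-! ### Perturbations of the uniform distribution -/

/-- The sign `±1` encoded by a Boolean. -/
def sgn (b : Bool) : ℝ := if b then 1 else -1

theorem abs_sgn (b : Bool) : |sgn b| = 1 := by cases b <;> simp [sgn]

theorem sgn_not (b : Bool) : sgn (!b) = -sgn b := by cases b <;> simp [sgn]

/-- The mass at `x` of the perturbation of the uniform distribution by the signs `z`. -/
def perturbedWeight {k : ℕ} (δ : ℝ) (z : Fin k → Bool) (x : Fin (2 * k)) : ℝ :=
  (1 + δ * sgn (z ⟨x / 2, by omega⟩) * (if x.val % 2 = 0 then 1 else -1)) / (2 * k)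

theorem perturbedWeight_oddElem {k : ℕ} (δ : ℝ) (z : Fin k → Bool) (i : Fin k) :
    perturbedWeight δ z (oddElem i) = (1 + δ * sgn (z i)) / (2 * k) := by
  have h : (⟨(oddElem i).val / 2, by omega⟩ : Fin k) = i := by ext; simp [oddElem]
  rw [perturbedWeight, h]
  simp [oddElem]

theorem perturbedWeight_evenElem {k : ℕ} (δ : ℝ) (z : Fin k → Bool) (i : Fin k) :
    perturbedWeight δ z (evenElem i) = (1 - δ * sgn (z i)) / (2 * k) := by
  have h : (⟨(evenElem i).val / 2, by omega⟩ : Fin k) = i := by ext; simp [evenElem]; omega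
  have h2 : (2 * i.val + 1) % 2 = 1 := by omega
  rw [perturbedWeight, h]
  simp [evenElem, h2, sub_eq_add_neg]

theorem perturbedWeight_nonneg {k : ℕ} {δ : ℝ} (hδ : |δ| ≤ 1) (z : Fin k → Bool)
    (x : Fin (2 * k)) : 0 ≤ perturbedWeight δ z x := by
  refine div_nonneg ?_ (by positivity)
  have h : |δ * sgn (z ⟨x / 2, by omega⟩) * (if x.val % 2 = 0 then 1 else -1)| ≤ 1 := by
    rw [abs_mul, abs_mul, abs_sgn]
    split_ifs <;> simpa using hδ
  linarith [(abs_le.1 h).1]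

theorem sum_perturbedWeight {k : ℕ} [NeZero k] (δ : ℝ) (z : Fin k → Bool) :
    ∑ x, perturbedWeight δ z x = 1 := by
  have hk : (k : ℝ) ≠ 0 := NeZero.ne _
  rw [sum_eq_sum_pairs]
  simp only [perturbedWeight_oddElem, perturbedWeight_evenElem]
  rw [Finset.sum_congr rfl fun i _ => show (1 + δ * sgn (z i)) / (2 * k)
    + (1 - δ * sgn (z i)) / (2 * k) = 1 / (k : ℝ) by field_simp; ring]
  simp [hk]

/-- The perturbation of the uniform distribution on `[2k]` which shifts the mass `δ / (2k)` inside
each pair `{2i - 1, 2i}`, in the direction given by the sign `z i`. -/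
def perturbed {k : ℕ} [NeZero k] (δ : ℝ) (hδ : |δ| ≤ 1) (z : Fin k → Bool) : PMF (Fin (2 * k)) :=
  PMF.ofFintype (fun x => ENNReal.ofReal (perturbedWeight δ z x)) (by
    rw [← ENNReal.ofReal_sum_of_nonneg fun x _ => perturbedWeight_nonneg hδ z x,
      sum_perturbedWeight, ENNReal.ofReal_one])

theorem toReal_perturbed {k : ℕ} [NeZero k] (δ : ℝ) (hδ : |δ| ≤ 1) (z : Fin k → Bool)
    (x : Fin (2 * k)) : (perturbed δ hδ z x).toReal = perturbedWeight δ z x := by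
  rw [perturbed, PMF.ofFintype_apply, ENNReal.toReal_ofReal (perturbedWeight_nonneg hδ z x)]

theorem toReal_uniformDist {k : ℕ} [NeZero k] (x : Fin (2 * k)) :
    (uniformDist k x).toReal = 1 / (2 * k) := by
  rw [uniformDist, PMF.uniformOfFintype_apply]
  simp

/-- The witness event picks from each pair the element favoured by the sign; each of the `k` pairs
contributes `δ / (2k)`. -/
theorem le_tvDist_perturbed {k : ℕ} [NeZero k] (δ : ℝ) (hδ : |δ| ≤ 1) (z : Fin k → Bool) :
    δ / 2 ≤ tvDist (perturbed δ hδ z) (uniformDist k) := by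
  have hk : (k : ℝ) ≠ 0 := NeZero.ne _
  classical
  refine le_trans (le_of_eq ?_) (le_ciSup (Set.finite_range _).bddAbove
    (Finset.univ.filter fun x => ∃ i, x = if z i then oddElem i else evenElem i))
  have hodd : ∀ i, (∃ j, oddElem i = if z j then oddElem j else evenElem j) ↔ z i = true := by
    intro i
    refine ⟨fun ⟨j, hj⟩ => ?_, fun h => ⟨i, by simp [h]⟩⟩
    split_ifs at hj with h
    · have : i = j := by ext; have := congrArg Fin.val hj; simp [oddElem] at this; omega
      rwa [this]
    · have := congrArg Fin.val hj
      simp [oddElem, evenElem] at this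
      omega
  have heven : ∀ i, (∃ j, evenElem i = if z j then oddElem j else evenElem j) ↔
      z i = false := by
    intro i
    refine ⟨fun ⟨j, hj⟩ => ?_, fun h => ⟨i, by simp [h]⟩⟩
    split_ifs at hj with h
    · have := congrArg Fin.val hj
      simp [oddElem, evenElem] at this
      omega
    · have : i = j := by ext; have := congrArg Fin.val hj; simp [evenElem] at this; omega
      rw [this]
      simpa using h
  rw [← Finset.sum_sub_distrib, Finset.sum_filter, sum_eq_sum_pairs]
  simp only [hodd, heven, toReal_perturbed, toReal_uniformDist, perturbedWeight_oddElem,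
    perturbedWeight_evenElem]
  rw [Finset.sum_congr rfl fun i _ => show _ = δ / (2 * k) by
    cases h : z i <;> simp [sgn] <;> ring]
  simp
  field_simp

/-! ### The messages of one user -/

section OneStep

variable {k : ℕ} {Y : Type u} (W : Channel k Y)

/-- The sum over all inputs `x` of the probabilities `W(y ∣ x)`. -/
def chanSum (y : Y) : ℝ := ∑ x, (W x y).toReal

/-- The normalized difference of the output probabilities within a pair of inputs. -/
def score (i : Fin k) (y : Y) : ℝ :=
  ((W (oddElem i) y).toReal - (W (evenElem i) y).toReal) / chanSum W y

theorem chanSum_nonneg (y : Y) : 0 ≤ chanSum W y :=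
  Finset.sum_nonneg fun _ _ => ENNReal.toReal_nonneg

/-- This cross-multiplied form survives the convention `0 / 0 = 0`: if the sum vanishes, so does
every summand. -/
theorem chanSum_mul_score (i : Fin k) (y : Y) :
    chanSum W y * score W i y = (W (oddElem i) y).toReal - (W (evenElem i) y).toReal := by
  by_cases h : chanSum W y = 0
  · have h0 := (Finset.sum_eq_zero_iff_of_nonneg fun x _ => ENNReal.toReal_nonneg).1 h
    rw [h, h0 _ (Finset.mem_univ _), h0 _ (Finset.mem_univ _)]
    simp
  · rw [score, mul_div_cancel₀ _ h]

/-- Each difference is at most the sum over its pair, and the pairs partition the inputs. This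
confines the ratio of one message to `[1 - δ, 1 + δ]`. -/
theorem sum_abs_score_le (y : Y) : ∑ i, |score W i y| ≤ 1 := by
  simp only [score, abs_div, abs_of_nonneg (chanSum_nonneg W y)]
  rw [← Finset.sum_div]
  refine div_le_one_of_le₀ ?_ (chanSum_nonneg W y)
  rw [chanSum, sum_eq_sum_pairs]
  refine Finset.sum_le_sum fun i _ => (abs_sub _ _).trans ?_
  rw [abs_of_nonneg ENNReal.toReal_nonneg, abs_of_nonneg ENNReal.toReal_nonneg]

theorem abs_score_le (i : Fin k) (y : Y) : |score W i y| ≤ 1 :=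
  (Finset.single_le_sum (f := fun i => |score W i y|) (fun _ _ => abs_nonneg _)
    (Finset.mem_univ i)).trans (sum_abs_score_le W y)

theorem isBdd_score (i : Fin k) : IsBdd (score W i) := ⟨1, abs_score_le W i⟩

/-- The likelihood ratio of the message of a user under a perturbation of the uniform
distribution. -/
def ratio (δ : ℝ) (z : Fin k → Bool) (y : Y) : ℝ := 1 + δ * ∑ i, sgn (z i) * score W i y

theorem abs_ratio_sub_one_le {δ : ℝ} (hδ : 0 ≤ δ) (z : Fin k → Bool) (y : Y) :
    |ratio W δ z y - 1| ≤ δ := by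
  rw [ratio, add_sub_cancel_left, abs_mul, abs_of_nonneg hδ]
  refine mul_le_of_le_one_right hδ ((Finset.abs_sum_le_sum_abs _ _).trans ?_)
  simpa only [abs_mul, abs_sgn, one_mul] using sum_abs_score_le W y

theorem isBdd_sum_mul_score (c : Fin k → ℝ) : IsBdd fun y => ∑ i, c i * score W i y :=
  IsBdd.sum _ fun i _ => (IsBdd.const _).mul (isBdd_score W i)

theorem isBdd_ratio (δ : ℝ) (z : Fin k → Bool) : IsBdd (ratio W δ z) :=
  (IsBdd.const _).add ((IsBdd.const _).mul (isBdd_sum_mul_score W _))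

theorem infoMatrix_diag_nonneg (i : Fin k) : 0 ≤ infoMatrix W i i := by
  rw [infoMatrix, Matrix.of_apply]
  exact tsum_nonneg fun y => div_nonneg (mul_self_nonneg _)
    (Finset.sum_nonneg fun _ _ => ENNReal.toReal_nonneg)

variable [NeZero k]

theorem toReal_uniformDist_bind (y : Y) :
    ((uniformDist k).bind W y).toReal = chanSum W y / (2 * k) := by
  rw [toReal_bind_apply, tsum_fintype]
  simp only [toReal_uniformDist]
  rw [← Finset.mul_sum, chanSum]
  ring

theorem toReal_perturbed_bind {δ : ℝ} (hδ : |δ| ≤ 1) (z : Fin k → Bool) (y : Y) :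
    ((perturbed δ hδ z).bind W y).toReal
      = ((uniformDist k).bind W y).toReal * ratio W δ z y := by
  have h : chanSum W y * ratio W δ z y = ∑ i, (((W (oddElem i) y).toReal
      + (W (evenElem i) y).toReal)
      + δ * sgn (z i) * ((W (oddElem i) y).toReal - (W (evenElem i) y).toReal)) := by
    rw [Finset.sum_add_distrib, ratio, mul_add, mul_one]
    congr 1
    · rw [chanSum, sum_eq_sum_pairs]
    · simp only [← chanSum_mul_score, Finset.mul_sum]
      exact Finset.sum_congr rfl fun i _ => by ring
  rw [toReal_uniformDist_bind, div_mul_eq_mul_div, h, toReal_bind_apply, tsum_fintype,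
    sum_eq_sum_pairs, Finset.sum_div]
  simp only [toReal_perturbed, perturbedWeight_oddElem, perturbedWeight_evenElem]
  exact Finset.sum_congr rfl fun i _ => by ring

theorem expect_perturbed_bind {δ : ℝ} (hδ : |δ| ≤ 1) (z : Fin k → Bool) (h : Y → ℝ) :
    expect ((perturbed δ hδ z).bind W) h
      = expect ((uniformDist k).bind W) fun y => ratio W δ z y * h y := by
  simp only [expect, toReal_perturbed_bind, mul_assoc]

theorem expect_score (i : Fin k) : expect ((uniformDist k).bind W) (score W i) = 0 := by
  have h : ∀ y, ((uniformDist k).bind W y).toReal * score W i y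
      = ((W (oddElem i) y).toReal - (W (evenElem i) y).toReal) * (1 / (2 * k)) := by
    intro y
    rw [toReal_uniformDist_bind, ← chanSum_mul_score]
    ring
  simp only [expect, h]
  rw [tsum_mul_right, (summable_toReal _).tsum_sub (summable_toReal _), tsum_toReal, tsum_toReal]
  simp

/-- The weight `chanSum W y / (2k)` of `y` under uniform samples cancels one of the two
denominators, which leaves the summand of `H(W)`. -/
theorem expect_score_mul_score (i j : Fin k) :
    expect ((uniformDist k).bind W) (fun y => score W i y * score W j y)
      = infoMatrix W i j / (2 * k) := by
  rw [infoMatrix, Matrix.of_apply, expect, ← tsum_div_const]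
  refine tsum_congr fun y => ?_
  rw [toReal_uniformDist_bind, ← chanSum_mul_score, ← chanSum_mul_score]
  rw [show ∑ x, (W x y).toReal = chanSum W y from rfl]
  by_cases h : chanSum W y = 0
  · simp [h]
  · field_simp

theorem expect_sum_mul_score (c : Fin k → ℝ) :
    expect ((uniformDist k).bind W) (fun y => ∑ i, c i * score W i y) = 0 := by
  rw [expect_sum _ fun i _ => (IsBdd.const _).mul (isBdd_score W i)]
  simp only [expect_const_mul, expect_score, mul_zero, Finset.sum_const_zero]

theorem expect_ratio (δ : ℝ) (z : Fin k → Bool) :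
    expect ((uniformDist k).bind W) (ratio W δ z) = 1 := by
  unfold ratio
  rw [expect_add (IsBdd.const _) ((IsBdd.const _).mul (isBdd_sum_mul_score W _)),
    expect_const, expect_const_mul, expect_sum_mul_score, mul_zero, add_zero]

theorem expect_sum_mul_score_sq (c : Fin k → ℝ) :
    expect ((uniformDist k).bind W) (fun y => (∑ i, c i * score W i y) ^ 2)
      = (∑ i, ∑ j, c i * c j * infoMatrix W i j) / (2 * k) := by
  have hb : ∀ i j, IsBdd fun y => c i * c j * (score W i y * score W j y) := fun i j =>
    (IsBdd.const _).mul ((isBdd_score W i).mul (isBdd_score W j))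
  have h : ∀ y, (∑ i, c i * score W i y) ^ 2
      = ∑ i, ∑ j, c i * c j * (score W i y * score W j y) := fun y => by
    rw [sq, Finset.sum_mul_sum]
    exact Finset.sum_congr rfl fun i _ => Finset.sum_congr rfl fun j _ => by ring
  simp only [h]
  rw [expect_sum _ fun i _ => IsBdd.sum _ fun j _ => hb i j, Finset.sum_div]
  refine Finset.sum_congr rfl fun i _ => ?_
  rw [expect_sum _ fun j _ => hb i j, Finset.sum_div]
  refine Finset.sum_congr rfl fun j _ => ?_
  rw [expect_const_mul, expect_score_mul_score]
  ring

/-- Cauchy–Schwarz for each message, then expectation. It shows that vanishing traces force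
vanishing quadratic forms, as needed when the nuclear norm is zero. -/
theorem quadForm_infoMatrix_le_trace (c : Fin k → ℝ) :
    ∑ i, ∑ j, c i * c j * infoMatrix W i j ≤ (∑ i, c i ^ 2) * (infoMatrix W).trace := by
  have hk : (0 : ℝ) < 2 * k := by have := NeZero.pos k; positivity
  have hb : ∀ i, IsBdd fun y => score W i y ^ 2 := fun i => (isBdd_score W i).pow 2
  have h := expect_mono (p := (uniformDist k).bind W) ((isBdd_sum_mul_score W c).pow 2)
    ((IsBdd.const (∑ i, c i ^ 2)).mul (IsBdd.sum Finset.univ fun i _ => hb i))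
    fun y => Finset.sum_mul_sq_le_sq_mul_sq Finset.univ c fun i => score W i y
  rw [expect_sum_mul_score_sq, expect_const_mul, expect_sum _ fun i _ => hb i] at h
  simp only [sq (score W _ _), expect_score_mul_score] at h
  rw [← Finset.sum_div, ← mul_div_assoc] at h
  exact (div_le_div_iff_of_pos_right hk).1 h

end OneStep

/-! ### Averages over the sign vectors -/

/-- The average over all sign vectors. -/
def mean {k : ℕ} (f : (Fin k → Bool) → ℝ) : ℝ := (∑ z, f z) / 2 ^ k

section Mean

variable {k : ℕ}

theorem mean_const (c : ℝ) : mean (fun _ : Fin k → Bool => c) = c := by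
  simp [mean]

theorem mean_add (f g : (Fin k → Bool) → ℝ) : mean (fun z => f z + g z) = mean f + mean g := by
  simp only [mean, Finset.sum_add_distrib, add_div]

theorem mean_const_mul (c : ℝ) (f : (Fin k → Bool) → ℝ) :
    mean (fun z => c * f z) = c * mean f := by
  simp only [mean, ← Finset.mul_sum, mul_div_assoc]

theorem mean_mono {f g : (Fin k → Bool) → ℝ} (h : ∀ z, f z ≤ g z) : mean f ≤ mean g := by
  unfold mean
  gcongr
  exact h _

theorem mean_sum {ι : Type*} (s : Finset ι) (f : ι → (Fin k → Bool) → ℝ) :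
    mean (fun z => ∑ i ∈ s, f i z) = ∑ i ∈ s, mean (f i) := by
  simp only [mean]
  rw [Finset.sum_comm, Finset.sum_div]

theorem sq_mean_div_mean_le (f : (Fin k → Bool) → ℝ) {g : (Fin k → Bool) → ℝ}
    (hg : ∀ z, 0 < g z) : mean f ^ 2 / mean g ≤ mean fun z => f z ^ 2 / g z := by
  have h := Finset.sq_sum_div_le_sum_sq_div Finset.univ f fun z _ => hg z
  have h2 : (0 : ℝ) < 2 ^ k := by positivity
  have h3 : 0 < ∑ z, g z := Finset.sum_pos (fun z _ => hg z) Finset.univ_nonempty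
  calc mean f ^ 2 / mean g = ((∑ z, f z) ^ 2 / ∑ z, g z) / 2 ^ k := by
        unfold mean
        field_simp
    _ ≤ _ := by
        unfold mean
        gcongr

theorem IsBdd.mean {α : Type*} {f : (Fin k → Bool) → α → ℝ} (hf : ∀ z, IsBdd (f z)) :
    IsBdd fun a => mean fun z => f z a := by
  simp only [InteractiveTesting.mean, div_eq_inv_mul]
  exact (IsBdd.const _).mul (IsBdd.sum _ fun z _ => hf z)

theorem expect_mean {α : Type*} {p : PMF α} {f : (Fin k → Bool) → α → ℝ}
    (hf : ∀ z, IsBdd (f z)) :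
    expect p (fun a => mean fun z => f z a) = mean fun z => expect p (f z) := by
  simp only [mean, div_eq_inv_mul]
  rw [expect_const_mul, expect_sum _ fun z _ => hf z]

/-- The sign vector `z` with the sign of coordinate `i` reversed. -/
def flip (i : Fin k) (z : Fin k → Bool) : Fin k → Bool := Function.update z i (!z i)

theorem flip_apply_self (i : Fin k) (z : Fin k → Bool) : flip i z i = !z i := by
  simp [flip]

theorem flip_apply_of_ne {i j : Fin k} (h : j ≠ i) (z : Fin k → Bool) : flip i z j = z j := by
  simp [flip, h]

theorem flip_involutive (i : Fin k) : Function.Involutive (flip i) := by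
  intro z
  ext j
  by_cases h : j = i
  · subst h
    simp [flip_apply_self]
  · simp [flip_apply_of_ne h]

theorem mean_flip (i : Fin k) (f : (Fin k → Bool) → ℝ) : (mean fun z => f (flip i z)) = mean f := by
  unfold mean
  congr 1
  exact Equiv.sum_comp (flip_involutive i).toPerm f

/-- Averaging with the flipped vector turns the numerator into a mean of `± (l - l') / 2` and the
denominator into a mean of `(l + l') / 2`. Convexity of `x² / y` moves the quotient inside the mean.
-/
theorem sq_mean_sgn_mul_div_le (i : Fin k) {l : (Fin k → Bool) → ℝ} (hl : ∀ z, 0 < l z) :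
    (mean fun z => sgn (z i) * l z) ^ 2 / mean l
      ≤ mean fun z => (√(l z) - √(l (flip i z))) ^ 2 := by
  have h1 : (mean fun z => sgn (z i) * l z)
      = mean fun z => sgn (z i) * (l z - l (flip i z)) / 2 := by
    have h := mean_flip i fun z => sgn (z i) * l z
    simp only [flip_apply_self, sgn_not] at h
    have h2 : (mean fun z => sgn (z i) * (l z - l (flip i z)) / 2)
        = mean fun z => (1 / 2) * (sgn (z i) * l z) + (1 / 2) * (-sgn (z i) * l (flip i z)) := by
      congr 1
      ext z
      ring
    rw [h2, mean_add, mean_const_mul, mean_const_mul, h]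
    ring
  have h2 : mean l = mean fun z => (l z + l (flip i z)) / 2 := by
    have h : (mean fun z => (l z + l (flip i z)) / 2)
        = mean fun z => (1 / 2) * l z + (1 / 2) * l (flip i z) := by
      congr 1
      ext z
      ring
    rw [h, mean_add, mean_const_mul, mean_const_mul, mean_flip]
    ring
  rw [h1, h2]
  refine (sq_mean_div_mean_le _ fun z => ?_).trans (mean_mono fun z => ?_)
  · have := hl z
    have := hl (flip i z)
    positivity
  · have ha := hl z
    have hb := hl (flip i z)
    have hs : sgn (z i) ^ 2 = 1 := by rw [← sq_abs, abs_sgn, one_pow]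
    rw [div_le_iff₀ (by positivity), div_pow, mul_pow, hs]
    have ea := Real.sq_sqrt ha.le
    have eb := Real.sq_sqrt hb.le
    set A := √(l z)
    set B := √(l (flip i z))
    rw [← ea, ← eb]
    -- Since `A² - B² = (A - B)(A + B)`, the claim reduces to `(A + B)² ≤ 2 (A² + B²)`.
    nlinarith [mul_nonneg (sq_nonneg (A - B)) (sq_nonneg (A - B))]

end Mean

theorem sq_sqrt_sub_sqrt_le {r s : ℝ} (hr : 0 ≤ r) (hs : 0 ≤ s) (h : 1 ≤ r + s) :
    (√r - √s) ^ 2 ≤ (r - s) ^ 2 := by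
  have er := Real.sq_sqrt hr
  have es := Real.sq_sqrt hs
  have h0 : r - s = (√r - √s) * (√r + √s) := by linear_combination -er + es
  have h1 : 1 ≤ (√r + √s) ^ 2 := by
    nlinarith [mul_nonneg (Real.sqrt_nonneg r) (Real.sqrt_nonneg s)]
  rw [h0, mul_pow]
  exact le_mul_of_one_le_right (sq_nonneg _) h1

/-! ### The transcript of a protocol -/

section Transcript

variable {k : ℕ} {Y : Type u} {𝒲 : Set (Channel k Y)} {n : ℕ} {Ω : Type v}
  [MeasurableSpace Ω] (P : Protocol 𝒲 n Ω) (ω : Ω)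

theorem expect_messageLaw_succ (p : PMF (Fin (2 * k))) {t : ℕ} (h : t + 1 ≤ n)
    {f : (Fin (t + 1) → Y) → ℝ} (hf : IsBdd f) :
    expect (P.messageLaw p ω (t + 1) h) f
      = expect (P.messageLaw p ω t (Nat.le_of_succ_le h)) fun past =>
          expect (p.bind (P.chan ⟨t, h⟩ past ω)) fun y => f (Fin.snoc (α := fun _ => Y) past y) := by
  rw [Protocol.messageLaw, expect_bind _ hf]
  congr 1
  ext past
  rw [← PMF.bind_bind, expect_bind _ hf]
  simp only [expect_pure]

theorem isBdd_expect_snoc (p : PMF (Fin (2 * k))) {t : ℕ} (h : t + 1 ≤ n)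
    {f : (Fin (t + 1) → Y) → ℝ} (hf : IsBdd f) :
    IsBdd fun past => expect (p.bind (P.chan ⟨t, h⟩ past ω)) fun y =>
      f (Fin.snoc (α := fun _ => Y) past y) := by
  obtain ⟨C, hC⟩ := hf
  exact IsBdd.expect (κ := fun past => p.bind (P.chan ⟨t, h⟩ past ω))
    (f := fun past y => f (Fin.snoc (α := fun _ => Y) past y)) (C := C) fun _ _ => hC _

/-- The likelihood ratio of the first `t` messages under a perturbation of the uniform
distribution. -/
def likelihood (δ : ℝ) (z : Fin k → Bool) : (t : ℕ) → t ≤ n → (Fin t → Y) → ℝ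
  | 0, _, _ => 1
  | t + 1, h, y => likelihood δ z t (Nat.le_of_succ_le h) (Fin.init y) *
      ratio (P.chan ⟨t, h⟩ (Fin.init y) ω) δ z (y (Fin.last t))

theorem likelihood_snoc (δ : ℝ) (z : Fin k → Bool) {t : ℕ} (h : t + 1 ≤ n) (past : Fin t → Y)
    (y : Y) : likelihood P ω δ z (t + 1) h (Fin.snoc (α := fun _ => Y) past y)
      = likelihood P ω δ z t (Nat.le_of_succ_le h) past
        * ratio (P.chan ⟨t, h⟩ past ω) δ z y := by
  rw [likelihood, Fin.init_snoc, Fin.snoc_last]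

/-- For `δ < 1` these bounds keep all likelihoods positive and all logarithms bounded, so every
expectation below is an absolutely convergent sum. -/
theorem likelihood_mem_Icc {δ : ℝ} (h0 : 0 ≤ δ) (h1 : δ ≤ 1) (z : Fin k → Bool) :
    ∀ (t : ℕ) (h : t ≤ n) (y : Fin t → Y),
      likelihood P ω δ z t h y ∈ Set.Icc ((1 - δ) ^ t) ((1 + δ) ^ t) := by
  intro t
  induction t with
  | zero => intro h y; simp [likelihood]
  | succ t ih =>
    intro h y
    obtain ⟨ha, hb⟩ := ih (Nat.le_of_succ_le h) (Fin.init y)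
    have hr := abs_le.1 (abs_ratio_sub_one_le (P.chan ⟨t, h⟩ (Fin.init y) ω) h0 z
      (y (Fin.last t)))
    rw [likelihood, pow_succ, pow_succ]
    have h1' : 0 ≤ 1 - δ := by linarith
    have hl : 0 ≤ likelihood P ω δ z t (Nat.le_of_succ_le h) (Fin.init y) :=
      (pow_nonneg h1' t).trans ha
    exact ⟨mul_le_mul ha (by linarith [hr.1]) h1' hl,
      mul_le_mul hb (by linarith [hr.2]) (by linarith [hr.1]) (by positivity)⟩

section Bounds

variable {δ : ℝ} (h0 : 0 ≤ δ) (h1 : δ < 1) (z : Fin k → Bool) {t : ℕ} (h : t ≤ n)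
include h0 h1

theorem likelihood_pos (y : Fin t → Y) : 0 < likelihood P ω δ z t h y :=
  (pow_pos (by linarith) t).trans_le (likelihood_mem_Icc P ω h0 h1.le z t h y).1

theorem isBdd_likelihood : IsBdd (likelihood P ω δ z t h) :=
  ⟨(1 + δ) ^ t, fun y => by
    rw [abs_of_pos (likelihood_pos P ω h0 h1 z h y)]
    exact (likelihood_mem_Icc P ω h0 h1.le z t h y).2⟩

end Bounds

theorem expect_messageLaw_perturbed [NeZero k] {δ : ℝ} (h0 : 0 ≤ δ) (h1 : δ < 1) (hδ : |δ| ≤ 1)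
    (z : Fin k → Bool) : ∀ (t : ℕ) (h : t ≤ n) (f : (Fin t → Y) → ℝ), IsBdd f →
      expect (P.messageLaw (perturbed δ hδ z) ω t h) f
        = expect (P.messageLaw (uniformDist k) ω t h) fun y => likelihood P ω δ z t h y * f y := by
  intro t
  induction t with
  | zero => intro h f _; simp [likelihood, Protocol.messageLaw, expect_pure]
  | succ t ih =>
    intro h f hf
    rw [expect_messageLaw_succ P ω _ h hf, ih _ _ (isBdd_expect_snoc P ω _ h hf),
      expect_messageLaw_succ P ω _ h ((isBdd_likelihood P ω h0 h1 z h).mul hf)]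
    simp only [likelihood_snoc, expect_perturbed_bind, mul_assoc, expect_const_mul]

/-- The likelihood ratio of the first `t` messages under the uniform mixture of the
perturbations of the uniform distribution. -/
def mixture (δ : ℝ) (t : ℕ) (h : t ≤ n) (y : Fin t → Y) : ℝ :=
  mean fun z => likelihood P ω δ z t h y

/-- The posterior mean of the sign of coordinate `i` given the first `t` messages. -/
def posterior (δ : ℝ) (t : ℕ) (h : t ≤ n) (i : Fin k) (y : Fin t → Y) : ℝ :=
  (mean fun z => sgn (z i) * likelihood P ω δ z t h y) / mixture P ω δ t h y

/-- The sum over the coordinates of the pointwise squared Hellinger distances between the laws of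
the first `t` messages for a sign vector and for its neighbor, averaged over sign vectors. -/
def hellinger (δ : ℝ) (t : ℕ) (h : t ≤ n) (y : Fin t → Y) : ℝ :=
  ∑ i : Fin k, mean fun z =>
    (√(likelihood P ω δ z t h y) - √(likelihood P ω δ (flip i z) t h y)) ^ 2

section

variable {δ : ℝ} (h0 : 0 ≤ δ) (h1 : δ < 1) {t : ℕ} (h : t ≤ n)
include h0 h1

theorem mixture_pos (y : Fin t → Y) : 0 < mixture P ω δ t h y := by
  refine lt_of_lt_of_le (pow_pos (by linarith : 0 < 1 - δ) t) ?_
  rw [← mean_const (k := k) ((1 - δ) ^ t)]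
  exact mean_mono fun z => (likelihood_mem_Icc P ω h0 h1.le z t h y).1

theorem isBdd_mixture : IsBdd (mixture P ω δ t h) :=
  IsBdd.mean fun z => isBdd_likelihood P ω h0 h1 z h

theorem isBdd_log_mixture : IsBdd fun y => Real.log (mixture P ω δ t h y) := by
  refine (isBdd_mixture P ω h0 h1 h).log ⟨((1 - δ) ^ t)⁻¹, fun y => ?_⟩
    (mixture_pos P ω h0 h1 h)
  have hp := mixture_pos P ω h0 h1 h y
  rw [abs_of_pos (inv_pos.2 hp)]
  refine inv_anti₀ (pow_pos (by linarith) t) ?_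
  rw [← mean_const (k := k) ((1 - δ) ^ t)]
  exact mean_mono fun z => (likelihood_mem_Icc P ω h0 h1.le z t h y).1

theorem isBdd_hellinger : IsBdd (hellinger P ω δ t h) :=
  IsBdd.sum _ fun i _ => IsBdd.mean fun z => ((isBdd_likelihood P ω h0 h1 z h).sqrt.sub
    (isBdd_likelihood P ω h0 h1 (flip i z) h).sqrt).pow 2

/-- Links the two growth estimates: knowledge of the signs is paid for in Hellinger distance. -/
theorem mixture_mul_sum_posterior_sq_le (y : Fin t → Y) :
    mixture P ω δ t h y * ∑ i, posterior P ω δ t h i y ^ 2 ≤ hellinger P ω δ t h y := by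
  rw [Finset.mul_sum]
  refine Finset.sum_le_sum fun i _ => ?_
  have hp := mixture_pos P ω h0 h1 h y
  refine le_trans (le_of_eq ?_) (sq_mean_sgn_mul_div_le i fun z =>
    likelihood_pos P ω h0 h1 z h y)
  rw [posterior, ← mixture]
  field_simp

theorem expect_mixture [NeZero k] :
    expect (P.messageLaw (uniformDist k) ω t h) (mixture P ω δ t h) = 1 := by
  unfold mixture
  rw [expect_mean fun z => isBdd_likelihood P ω h0 h1 z h]
  have hδ : |δ| ≤ 1 := by rw [abs_of_nonneg h0]; exact h1.le
  have hz : ∀ z, expect (P.messageLaw (uniformDist k) ω t h) (likelihood P ω δ z t h) = 1 := by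
    intro z
    have := expect_messageLaw_perturbed P ω h0 h1 hδ z t h (fun _ => 1) (IsBdd.const 1)
    simpa [expect_const] using this.symm
  simp only [hz, mean_const]

end

/-! ### Growth of the Hellinger sum and of the divergence, message by message -/

theorem mixture_snoc {δ : ℝ} (h0 : 0 ≤ δ) (h1 : δ < 1) {t : ℕ} (h : t + 1 ≤ n)
    (past : Fin t → Y) (y : Y) :
    mixture P ω δ (t + 1) h (Fin.snoc (α := fun _ => Y) past y)
      = mixture P ω δ t (Nat.le_of_succ_le h) past * (1 + δ * ∑ i,
          posterior P ω δ t (Nat.le_of_succ_le h) i past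
            * score (P.chan ⟨t, h⟩ past ω) i y) := by
  have hp := (mixture_pos P ω h0 h1 (Nat.le_of_succ_le h) past).ne'
  have h2 : ∀ i, mixture P ω δ t (Nat.le_of_succ_le h) past *
      (posterior P ω δ t (Nat.le_of_succ_le h) i past * score (P.chan ⟨t, h⟩ past ω) i y)
      = score (P.chan ⟨t, h⟩ past ω) i y *
        mean fun z => sgn (z i) * likelihood P ω δ z t (Nat.le_of_succ_le h) past := by
    intro i
    rw [posterior]
    field_simp
  rw [mul_add, mul_one, mul_left_comm, Finset.mul_sum, Finset.sum_congr rfl fun i _ => h2 i]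
  simp only [← mean_const_mul, ← mean_sum]
  rw [mixture, mixture, ← mean_add]
  congr 1
  ext z
  rw [likelihood_snoc, ratio, mul_add, mul_one, Finset.mul_sum, Finset.mul_sum, Finset.mul_sum]
  congr 1
  exact Finset.sum_congr rfl fun i _ => by ring

/-- Flipping sign `i` changes the ratio of the new message only by `2 δ z_i s_i`, whose mean square
is proportional to `H_ii`; summing over `i` gives the trace. -/
theorem expect_hellinger_snoc_le [NeZero k] {δ : ℝ} (h0 : 0 ≤ δ) (h1 : δ ≤ 1 / 2) {t : ℕ}
    (h : t + 1 ≤ n) (past : Fin t → Y) :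
    expect ((uniformDist k).bind (P.chan ⟨t, h⟩ past ω))
        (fun y => hellinger P ω δ (t + 1) h (Fin.snoc (α := fun _ => Y) past y))
      ≤ hellinger P ω δ t (Nat.le_of_succ_le h) past
        + 2 * δ ^ 2 / k * (infoMatrix (P.chan ⟨t, h⟩ past ω)).trace
          * mixture P ω δ t (Nat.le_of_succ_le h) past := by
  have hlt : δ < 1 := by linarith
  have hk : (k : ℝ) ≠ 0 := NeZero.ne _
  set W := P.chan ⟨t, h⟩ past ω with hW
  set l := fun z => likelihood P ω δ z t (Nat.le_of_succ_le h) past with hl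
  have hpos : ∀ z, 0 < l z := fun z => likelihood_pos P ω h0 hlt z _ past
  have hrpos : ∀ z y, 1 / 2 ≤ ratio W δ z y := fun z y => by
    linarith [(abs_le.1 (abs_ratio_sub_one_le W h0 z y)).1]
  have hbd : ∀ i z, IsBdd fun y =>
      (√(l z * ratio W δ z y) - √(l (flip i z) * ratio W δ (flip i z) y)) ^ 2 := fun i z =>
    (((IsBdd.const _).mul (isBdd_ratio W δ z)).sqrt.sub
      ((IsBdd.const _).mul (isBdd_ratio W δ (flip i z))).sqrt).pow 2
  have hdiff : ∀ i z y, ratio W δ z y - ratio W δ (flip i z) y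
      = 2 * δ * sgn (z i) * score W i y := by
    intro i z y
    have : ∑ j, sgn (z j) * score W j y - ∑ j, sgn (flip i z j) * score W j y
        = 2 * sgn (z i) * score W i y := by
      rw [← Finset.sum_sub_distrib, Finset.sum_eq_single i]
      · rw [flip_apply_self, sgn_not]
        ring
      · intro j _ hj
        rw [flip_apply_of_ne hj, sub_self]
      · simp
    rw [ratio, ratio]
    linear_combination δ * this
  -- Expand the square and bound its cross term by `2 √(r s) = r + s - (√r - √s)² ≥ r + s - (r -
  -- s)²`. This needs `r + s ≥ 1`, which holds as both ratios are at least `1 / 2`. The resulting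
  -- bound is linear in `r` and `s`, which have mean one.
  have hpt : ∀ i z y,
      (√(l z * ratio W δ z y) - √(l (flip i z) * ratio W δ (flip i z) y)) ^ 2
        ≤ (l z - √(l z) * √(l (flip i z))) * ratio W δ z y
          + ((l (flip i z) - √(l z) * √(l (flip i z))) * ratio W δ (flip i z) y
          + 4 * δ ^ 2 * (√(l z) * √(l (flip i z))) * (score W i y * score W i y)) := by
    intro i z y
    have hr := hrpos z y
    have hs := hrpos (flip i z) y
    have hle := sq_sqrt_sub_sqrt_le (r := ratio W δ z y) (s := ratio W δ (flip i z) y)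
      (by linarith) (by linarith) (by linarith)
    have hsg : sgn (z i) ^ 2 = 1 := by rw [← sq_abs, abs_sgn, one_pow]
    rw [hdiff, mul_pow, mul_pow, hsg] at hle
    rw [Real.sqrt_mul (hpos z).le, Real.sqrt_mul (hpos (flip i z)).le]
    have e1 := Real.sq_sqrt (hpos z).le
    have e2 := Real.sq_sqrt (hpos (flip i z)).le
    have e3 := Real.sq_sqrt (by linarith : 0 ≤ ratio W δ z y)
    have e4 := Real.sq_sqrt (by linarith : 0 ≤ ratio W δ (flip i z) y)
    have hAB : 0 ≤ √(l z) * √(l (flip i z)) := by positivity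
    have hm := mul_le_mul_of_nonneg_left hle hAB
    set A := √(l z)
    set B := √(l (flip i z))
    set a := √(ratio W δ z y)
    set b := √(ratio W δ (flip i z) y)
    rw [← e1, ← e2, ← e3, ← e4]
    nlinarith [hm]
  have hE : ∀ i z, expect ((uniformDist k).bind W) (fun y =>
      (√(l z * ratio W δ z y) - √(l (flip i z) * ratio W δ (flip i z) y)) ^ 2)
        ≤ (√(l z) - √(l (flip i z))) ^ 2
          + δ ^ 2 / k * infoMatrix W i i * (l z + l (flip i z)) := by
    intro i z
    have b1 : IsBdd fun y => (l z - √(l z) * √(l (flip i z))) * ratio W δ z y :=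
      (IsBdd.const _).mul (isBdd_ratio W δ z)
    have b2 : IsBdd fun y =>
        (l (flip i z) - √(l z) * √(l (flip i z))) * ratio W δ (flip i z) y :=
      (IsBdd.const _).mul (isBdd_ratio W δ _)
    have b3 : IsBdd fun y =>
        4 * δ ^ 2 * (√(l z) * √(l (flip i z))) * (score W i y * score W i y) :=
      (IsBdd.const _).mul ((isBdd_score W i).mul (isBdd_score W i))
    refine (expect_mono (hbd i z) (b1.add (b2.add b3)) (hpt i z)).trans ?_
    rw [expect_add b1 (b2.add b3), expect_add b2 b3]
    simp only [expect_const_mul, expect_ratio, expect_score_mul_score]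
    have e1 := Real.sq_sqrt (hpos z).le
    have e2 := Real.sq_sqrt (hpos (flip i z)).le
    have hH : 0 ≤ δ ^ 2 / k * infoMatrix W i i :=
      mul_nonneg (by positivity) (infoMatrix_diag_nonneg W i)
    have h5 : 2 * (√(l z) * √(l (flip i z))) ≤ l z + l (flip i z) := by
      nlinarith [sq_nonneg (√(l z) - √(l (flip i z)))]
    have h6 := mul_le_mul_of_nonneg_left h5 hH
    have h7 : 4 * δ ^ 2 * (√(l z) * √(l (flip i z))) * (infoMatrix W i i / (2 * k))
        = δ ^ 2 / k * infoMatrix W i i * (2 * (√(l z) * √(l (flip i z)))) := by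
      field_simp
      ring
    rw [h7]
    nlinarith
  have hfun : ∀ y, hellinger P ω δ (t + 1) h (Fin.snoc (α := fun _ => Y) past y)
      = ∑ i : Fin k, mean fun z =>
        (√(l z * ratio W δ z y) - √(l (flip i z) * ratio W δ (flip i z) y)) ^ 2 := by
    intro y
    simp only [hellinger, likelihood_snoc, hl, hW]
  simp only [hfun]
  rw [expect_sum _ fun i _ => IsBdd.mean (hbd i)]
  have hrhs : hellinger P ω δ t (Nat.le_of_succ_le h) past
        + 2 * δ ^ 2 / k * (infoMatrix W).trace * mixture P ω δ t (Nat.le_of_succ_le h) past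
      = ∑ i : Fin k, mean fun z => (√(l z) - √(l (flip i z))) ^ 2
          + δ ^ 2 / k * infoMatrix W i i * (l z + l (flip i z)) := by
    simp only [mean_add, mean_const_mul, Finset.sum_add_distrib, mean_flip]
    rw [hellinger, Matrix.trace, mixture, Finset.mul_sum, Finset.sum_mul]
    congr 1
    refine Finset.sum_congr rfl fun i _ => ?_
    rw [Matrix.diag_apply]
    ring
  rw [hrhs]
  refine Finset.sum_le_sum fun i _ => ?_
  rw [expect_mean (hbd i)]
  exact mean_mono (hE i)

theorem expect_hellinger_le [NeZero k] {δ b : ℝ} (h0 : 0 ≤ δ) (h1 : δ ≤ 1 / 2)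
    (hb : ∀ W ∈ 𝒲, (infoMatrix W).trace ≤ b) : ∀ (t : ℕ) (h : t ≤ n),
    expect (P.messageLaw (uniformDist k) ω t h) (hellinger P ω δ t h)
      ≤ t * (2 * δ ^ 2 / k * b) := by
  have hlt : δ < 1 := by linarith
  intro t
  induction t with
  | zero => intro h; simp [Protocol.messageLaw, expect_pure, hellinger, likelihood, mean_const]
  | succ t ih =>
    intro h
    have hbm := isBdd_mixture P ω h0 hlt (Nat.le_of_succ_le h)
    have hbh := isBdd_hellinger P ω h0 hlt (Nat.le_of_succ_le h)
    rw [expect_messageLaw_succ P ω _ h (isBdd_hellinger P ω h0 hlt h)]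
    refine (expect_mono (isBdd_expect_snoc P ω _ h (isBdd_hellinger P ω h0 hlt h))
      (hbh.add ((IsBdd.const (2 * δ ^ 2 / k * b)).mul hbm)) fun past => ?_).trans ?_
    · refine (expect_hellinger_snoc_le P ω h0 h1 h past).trans ?_
      have := mixture_pos P ω h0 hlt (Nat.le_of_succ_le h) past
      have := hb _ (P.chan_mem ⟨t, h⟩ past ω)
      gcongr
    · rw [expect_add hbh ((IsBdd.const _).mul hbm), expect_const_mul,
        expect_mixture P ω h0 hlt]
      have := ih (Nat.le_of_succ_le h)
      push_cast
      linarith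

/-- The new factor is `1 + u` with `u` centred, so after `log (1 + u) ≤ u` only the second moment of
`u` survives; it is the quadratic form of `H` at the posterior mean. -/
theorem expect_mixture_mul_log_snoc_le [NeZero k] {δ a : ℝ} (h0 : 0 ≤ δ) (h1 : δ < 1)
    (ha0 : 0 ≤ a)
    (ha : ∀ W ∈ 𝒲, ∀ c : Fin k → ℝ, ∑ i, ∑ j, c i * c j * infoMatrix W i j ≤ a * ∑ i, c i ^ 2)
    {t : ℕ} (h : t + 1 ≤ n) (past : Fin t → Y) :
    expect ((uniformDist k).bind (P.chan ⟨t, h⟩ past ω))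
        (fun y => mixture P ω δ (t + 1) h (Fin.snoc (α := fun _ => Y) past y)
          * Real.log (mixture P ω δ (t + 1) h (Fin.snoc (α := fun _ => Y) past y)))
      ≤ mixture P ω δ t (Nat.le_of_succ_le h) past
          * Real.log (mixture P ω δ t (Nat.le_of_succ_le h) past)
        + δ ^ 2 * a / (2 * k) * hellinger P ω δ t (Nat.le_of_succ_le h) past := by
  have hk : (0 : ℝ) < k := by exact_mod_cast NeZero.pos k
  have hB := ((isBdd_mixture P ω h0 h1 h).mul (isBdd_log_mixture P ω h0 h1 h)).comp
    fun y : Y => (Fin.snoc (α := fun _ => Y) past y)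
  have hpos' : ∀ y, 0 < mixture P ω δ (t + 1) h (Fin.snoc (α := fun _ => Y) past y) :=
    fun y => mixture_pos P ω h0 h1 h _
  have hpost := mixture_mul_sum_posterior_sq_le P ω h0 h1 (Nat.le_of_succ_le h) past
  have hq := ha _ (P.chan_mem ⟨t, h⟩ past ω)
    fun i => posterior P ω δ t (Nat.le_of_succ_le h) i past
  have hpos := mixture_pos P ω h0 h1 (Nat.le_of_succ_le h) past
  simp only [mixture_snoc P ω h0 h1] at hB hpos' ⊢
  set W := P.chan ⟨t, h⟩ past ω
  set l := mixture P ω δ t (Nat.le_of_succ_le h) past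
  set c := fun i => posterior P ω δ t (Nat.le_of_succ_le h) i past
  have hs := isBdd_sum_mul_score W c
  have b1 := (IsBdd.const (α := Y) (δ * l * (Real.log l + 1))).mul hs
  have b2 := (IsBdd.const (α := Y) (δ ^ 2 * l)).mul (hs.pow 2)
  refine (expect_mono hB ((IsBdd.const (l * Real.log l)).add (b1.add b2)) fun y => ?_).trans ?_
  · have hy : 0 < 1 + δ * ∑ i, c i * score W i y := (mul_pos_iff_of_pos_left hpos).1 (hpos' y)
    have hlog : Real.log (l * (1 + δ * ∑ i, c i * score W i y))
        ≤ Real.log l + δ * ∑ i, c i * score W i y := by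
      rw [Real.log_mul hpos.ne' hy.ne']
      linarith [Real.log_le_sub_one_of_pos hy]
    refine (mul_le_mul_of_nonneg_left hlog (hpos' y).le).trans (le_of_eq ?_)
    ring
  · rw [expect_add (IsBdd.const _) (b1.add b2), expect_add b1 b2]
    simp only [expect_const, expect_const_mul, expect_sum_mul_score, expect_sum_mul_score_sq]
    have h3 : (∑ i, ∑ j, c i * c j * infoMatrix W i j) * l
        ≤ a * hellinger P ω δ t (Nat.le_of_succ_le h) past := by
      calc _ ≤ (a * ∑ i, c i ^ 2) * l := mul_le_mul_of_nonneg_right hq hpos.le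
        _ = a * (l * ∑ i, c i ^ 2) := by ring
        _ ≤ _ := mul_le_mul_of_nonneg_left hpost ha0
    have h4 := mul_le_mul_of_nonneg_left h3 (by positivity : 0 ≤ δ ^ 2 / (2 * k))
    have h5 : δ ^ 2 * l * ((∑ i, ∑ j, c i * c j * infoMatrix W i j) / (2 * k))
        = δ ^ 2 / (2 * k) * ((∑ i, ∑ j, c i * c j * infoMatrix W i j) * l) := by ring
    have h6 : δ ^ 2 * a / (2 * k) * hellinger P ω δ t (Nat.le_of_succ_le h) past
        = δ ^ 2 / (2 * k) * (a * hellinger P ω δ t (Nat.le_of_succ_le h) past) := by ring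
    rw [h5, h6]
    linarith

theorem expect_mixture_mul_log_le [NeZero k] {δ a b : ℝ} (h0 : 0 ≤ δ) (h1 : δ ≤ 1 / 2)
    (ha0 : 0 ≤ a) (hb0 : 0 ≤ b)
    (ha : ∀ W ∈ 𝒲, ∀ c : Fin k → ℝ, ∑ i, ∑ j, c i * c j * infoMatrix W i j ≤ a * ∑ i, c i ^ 2)
    (hb : ∀ W ∈ 𝒲, (infoMatrix W).trace ≤ b) : ∀ (t : ℕ) (h : t ≤ n),
    expect (P.messageLaw (uniformDist k) ω t h)
        (fun y => mixture P ω δ t h y * Real.log (mixture P ω δ t h y))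
      ≤ δ ^ 4 * a * b / k ^ 2 * t ^ 2 := by
  have hlt : δ < 1 := by linarith
  have hk : (0 : ℝ) < k := by exact_mod_cast NeZero.pos k
  intro t
  induction t with
  | zero => intro h; simp [mixture, likelihood, mean_const, expect_const]
  | succ t ih =>
    intro h
    have hB := fun (s : ℕ) (h : s ≤ n) =>
      (isBdd_mixture P ω h0 hlt h).mul (isBdd_log_mixture P ω h0 hlt h)
    have hbh := isBdd_hellinger P ω h0 hlt (Nat.le_of_succ_le h)
    rw [expect_messageLaw_succ P ω _ h (hB _ h)]
    refine (expect_mono (isBdd_expect_snoc P ω _ h (hB _ h))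
      ((hB _ (Nat.le_of_succ_le h)).add ((IsBdd.const (δ ^ 2 * a / (2 * k))).mul hbh))
      (expect_mixture_mul_log_snoc_le P ω h0 hlt ha0 ha h)).trans ?_
    rw [expect_add (hB _ _) ((IsBdd.const _).mul hbh), expect_const_mul]
    have h2 := ih (Nat.le_of_succ_le h)
    have h3 := mul_le_mul_of_nonneg_left
      (expect_hellinger_le P ω h0 h1 hb t (Nat.le_of_succ_le h))
      (by positivity : 0 ≤ δ ^ 2 * a / (2 * k))
    have h4 : δ ^ 2 * a / (2 * k) * (t * (2 * δ ^ 2 / k * b))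
        = δ ^ 4 * a * b / k ^ 2 * t := by
      field_simp
    have h5 : 0 ≤ δ ^ 4 * a * b / k ^ 2 := by positivity
    have h6 : (0 : ℝ) ≤ t := by positivity
    rw [h4] at h3
    push_cast
    -- The increment is a constant times `t`, and `t² + t ≤ (t + 1)²`.
    nlinarith [mul_nonneg h5 h6]

/-- The convex function `x log x` lies above its tangents at `1` and at `e`. Interpolating between
the two with weight `f` bounds `x f` pointwise, and `E[M] = 1` then gives the constant `e - 2`,
which is below `98 / 100`. -/
theorem expect_mixture_mul_le [NeZero k] {δ : ℝ} (h0 : 0 ≤ δ) (h1 : δ < 1) {t : ℕ} (h : t ≤ n)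
    {f : (Fin t → Y) → ℝ} (hf : ∀ y, f y ∈ Set.Icc 0 1) :
    expect (P.messageLaw (uniformDist k) ω t h) (fun y => mixture P ω δ t h y * f y)
      ≤ expect (P.messageLaw (uniformDist k) ω t h) f
        + expect (P.messageLaw (uniformDist k) ω t h)
            (fun y => mixture P ω δ t h y * Real.log (mixture P ω δ t h y))
        + (Real.exp 1 - 2) := by
  have hfb : IsBdd f := ⟨1, fun y => by rw [abs_of_nonneg (hf y).1]; exact (hf y).2⟩
  have hm := isBdd_mixture P ω h0 h1 h
  have hml := hm.mul (isBdd_log_mixture P ω h0 h1 h)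
  have b1 := hml.sub hm
  have key := expect_mono (p := P.messageLaw (uniformDist k) ω t h) (hm.mul hfb)
    (hfb.add (b1.add (IsBdd.const (Real.exp 1 - 1)))) fun y => by
      have hp := mixture_pos P ω h0 h1 h y
      set x := mixture P ω δ t h y
      obtain ⟨hf0, hf1⟩ := hf y
      have e1 : 0 ≤ x * Real.log x - x + 1 := by
        have := mul_le_mul_of_nonneg_left (Real.one_sub_inv_le_log_of_pos hp) hp.le
        rw [mul_sub, mul_inv_cancel₀ hp.ne'] at this
        linarith
      have e2 : 0 ≤ x * Real.log x - 2 * x + Real.exp 1 := by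
        have h3 := Real.one_sub_inv_le_log_of_pos (div_pos hp (Real.exp_pos 1))
        rw [Real.log_div hp.ne' (Real.exp_pos 1).ne', Real.log_exp, inv_div] at h3
        have := mul_le_mul_of_nonneg_left h3 hp.le
        rw [mul_sub, mul_div_cancel₀ _ hp.ne'] at this
        linarith
      have e3 : 2 ≤ Real.exp 1 := by linarith [Real.add_one_le_exp 1]
      show x * f y ≤ f y + (x * Real.log x - x + (Real.exp 1 - 1))
      nlinarith [mul_nonneg hf0 e2, mul_nonneg (sub_nonneg.2 hf1) e1,
        mul_nonneg (sub_nonneg.2 hf1) (sub_nonneg.2 e3)]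
  rw [expect_add hfb (b1.add (IsBdd.const _)), expect_add b1 (IsBdd.const _),
    expect_sub hml hm, expect_const, expect_mixture P ω h0 h1] at key
  linarith

end Transcript

/-! ### The lower bound -/

/-- Superadditivity of the lower integral holds for arbitrary functions, and this direction
suffices. -/
theorem sum_lintegral_le_lintegral_sum {Ω ι : Type*} [MeasurableSpace Ω]
    (μ : MeasureTheory.Measure Ω) (s : Finset ι) (f : ι → Ω → ℝ≥0∞) :
    ∑ i ∈ s, ∫⁻ ω, f i ω ∂μ ≤ ∫⁻ ω, ∑ i ∈ s, f i ω ∂μ := by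
  classical
  induction s using Finset.induction_on with
  | empty => simp
  | insert i s hi ih =>
    simp only [Finset.sum_insert hi]
    exact (add_le_add le_rfl ih).trans (MeasureTheory.le_lintegral_add _ _)

section Testing

variable {k : ℕ} {Y : Type u} {𝒲 : Set (Channel k Y)} {n : ℕ} {Ω : Type v}
  [MeasurableSpace Ω] (P : Protocol 𝒲 n Ω) (T : Decision Y n Ω) (ω : Ω)

theorem toReal_messageLaw_bind_out (p : PMF (Fin (2 * k))) (b : Bool) :
    (((P.messageLaw p ω n le_rfl).bind fun y => T.out y ω) b).toReal
      = expect (P.messageLaw p ω n le_rfl) fun y => (T.out y ω b).toReal := by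
  rw [toReal_bind_apply, expect]

theorem toReal_out_mem_Icc (y : Fin n → Y) (b : Bool) : (T.out y ω b).toReal ∈ Set.Icc 0 1 :=
  ⟨ENNReal.toReal_nonneg, ENNReal.toReal_le_of_le_ofReal zero_le_one
    (by simpa using (T.out y ω).coe_le_one b)⟩

variable [NeZero k]

theorem mean_out_perturbed_le {δ a b : ℝ} (h0 : 0 ≤ δ) (h1 : δ ≤ 1 / 2) (hδ : |δ| ≤ 1)
    (ha0 : 0 ≤ a) (hb0 : 0 ≤ b)
    (ha : ∀ W ∈ 𝒲, ∀ c : Fin k → ℝ, ∑ i, ∑ j, c i * c j * infoMatrix W i j ≤ a * ∑ i, c i ^ 2)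
    (hb : ∀ W ∈ 𝒲, (infoMatrix W).trace ≤ b) (d : Bool) :
    (mean fun z => (((P.messageLaw (perturbed δ hδ z) ω n le_rfl).bind
        fun y => T.out y ω) d).toReal)
      ≤ (((P.messageLaw (uniformDist k) ω n le_rfl).bind fun y => T.out y ω) d).toReal
        + (δ ^ 4 * a * b / k ^ 2 * n ^ 2 + (Real.exp 1 - 2)) := by
  have hlt : δ < 1 := by linarith
  have hf := fun y => toReal_out_mem_Icc T ω y d
  have hfb : IsBdd fun y => (T.out y ω d).toReal :=
    ⟨1, fun y => by rw [abs_of_nonneg (hf y).1]; exact (hf y).2⟩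
  have h2 := expect_mixture_mul_le P ω h0 hlt le_rfl hf
  have h3 := expect_mixture_mul_log_le P ω h0 h1 ha0 hb0 ha hb n le_rfl
  have h4 : ∀ z, IsBdd fun y => likelihood P ω δ z n le_rfl y * (T.out y ω d).toReal :=
    fun z => (isBdd_likelihood P ω h0 hlt z le_rfl).mul hfb
  simp only [toReal_messageLaw_bind_out,
    expect_messageLaw_perturbed P ω h0 hlt hδ _ n le_rfl _ hfb]
  rw [← expect_mean h4]
  have h5 : ∀ y, (mean fun z => likelihood P ω δ z n le_rfl y * (T.out y ω d).toReal)
      = mixture P ω δ n le_rfl y * (T.out y ω d).toReal := by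
    intro y
    simp only [mul_comm _ (T.out y ω d).toReal, mean_const_mul, mixture]
  simp only [h5]
  linarith

theorem le_of_isIdentityTest {μ : MeasureTheory.Measure Ω} [MeasureTheory.IsProbabilityMeasure μ]
    {ε a b : ℝ} (hε : 0 < ε) (hε' : ε ≤ 1 / 4) (hT : IsIdentityTest (uniformDist k) ε μ P T)
    (ha0 : 0 ≤ a) (hb0 : 0 ≤ b)
    (ha : ∀ W ∈ 𝒲, ∀ c : Fin k → ℝ, ∑ i, ∑ j, c i * c j * infoMatrix W i j ≤ a * ∑ i, c i ^ 2)
    (hb : ∀ W ∈ 𝒲, (infoMatrix W).trace ≤ b) :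
    (k : ℝ) ^ 2 ≤ 64 * (n ^ 2 * ε ^ 4 * (a * b)) := by
  obtain ⟨hu, hp⟩ := hT
  have hk : (0 : ℝ) < k := by exact_mod_cast NeZero.pos k
  -- The perturbation has size `δ = 2ε ≤ 1 / 2`, at total variation distance at least `δ / 2 = ε`.
  have hδ : |2 * ε| ≤ 1 := by rw [abs_of_nonneg (by linarith)]; linarith
  set A : (Fin k → Bool) → Ω → ℝ≥0∞ := fun z ω =>
    ((P.messageLaw (perturbed (2 * ε) hδ z) ω n le_rfl).bind fun y => T.out y ω) true
  set B : Bool → Ω → ℝ≥0∞ := fun d ω =>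
    ((P.messageLaw (uniformDist k) ω n le_rfl).bind fun y => T.out y ω) d
  set η : ℝ := (2 * ε) ^ 4 * a * b / k ^ 2 * n ^ 2 + (Real.exp 1 - 2)
  have hη0 : 0 ≤ η := by
    have : 2 ≤ Real.exp 1 := by linarith [Real.add_one_le_exp 1]
    have : 0 ≤ (2 * ε) ^ 4 * a * b / k ^ 2 * n ^ 2 := by positivity
    linarith
  have hAB : ∀ ω, ∑ z, A z ω ≤ 2 ^ k * (B true ω + ENNReal.ofReal η) := by
    intro ω
    have h := mean_out_perturbed_le P T ω (by linarith) (by linarith) hδ ha0 hb0 ha hb true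
    rw [mean, div_le_iff₀ (by positivity), mul_comm _ ((2 : ℝ) ^ k),
      ← ENNReal.toReal_sum fun z _ => PMF.apply_ne_top _ _] at h
    have hBt : B true ω ≠ ⊤ := PMF.apply_ne_top _ _
    rw [← ENNReal.ofReal_toReal (a := ∑ z, A z ω)
      (ENNReal.sum_ne_top.2 fun z _ => PMF.apply_ne_top _ _)]
    refine (ENNReal.ofReal_le_ofReal h).trans (le_of_eq ?_)
    rw [ENNReal.ofReal_mul (by positivity), ENNReal.ofReal_add ENNReal.toReal_nonneg hη0,
      ENNReal.ofReal_toReal hBt, ENNReal.ofReal_pow (by norm_num)]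
    simp
  have hlow : (2 : ℝ≥0∞) ^ k * (99 / 100) ≤ ∑ z, ∫⁻ ω, A z ω ∂μ := by
    have h : ∀ z : Fin k → Bool, (99 / 100 : ℝ≥0∞) ≤ ∫⁻ ω, A z ω ∂μ := fun z =>
      hp _ (by simpa using le_tvDist_perturbed (2 * ε) hδ z)
    calc (2 : ℝ≥0∞) ^ k * (99 / 100) = ∑ _z : Fin k → Bool, (99 / 100 : ℝ≥0∞) := by simp
      _ ≤ _ := Finset.sum_le_sum fun z _ => h z
  have hup : ∑ z, ∫⁻ ω, A z ω ∂μ ≤ 2 ^ k * (∫⁻ ω, B true ω ∂μ + ENNReal.ofReal η) := by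
    refine (sum_lintegral_le_lintegral_sum μ _ A).trans
      ((MeasureTheory.lintegral_mono hAB).trans (le_of_eq ?_))
    rw [MeasureTheory.lintegral_const_mul' _ _ (by simp),
      MeasureTheory.lintegral_add_right _ measurable_const]
    simp
  have h99 : (99 / 100 : ℝ≥0∞) ≤ ∫⁻ ω, B true ω ∂μ + ENNReal.ofReal η :=
    (ENNReal.mul_le_mul_iff_right (by simp) (by simp)).1 (hlow.trans hup)
  have hsum : ∫⁻ ω, B true ω ∂μ + ∫⁻ ω, B false ω ∂μ ≤ 1 := by
    refine (MeasureTheory.le_lintegral_add _ _).trans (le_of_eq ?_)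
    have : ∀ ω, B true ω + B false ω = 1 := fun ω => by
      have := PMF.tsum_coe ((P.messageLaw (uniformDist k) ω n le_rfl).bind fun y => T.out y ω)
      rwa [tsum_fintype, Fintype.sum_bool] at this
    simp [this]
  have hfalse : (99 / 100 : ℝ≥0∞) ≤ ∫⁻ ω, B false ω ∂μ := hu
  have ht : ∫⁻ ω, B true ω ∂μ ≠ ⊤ := ne_top_of_le_ne_top ENNReal.one_ne_top
    (le_self_add.trans hsum)
  have hf : ∫⁻ ω, B false ω ∂μ ≠ ⊤ := ne_top_of_le_ne_top ENNReal.one_ne_top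
    (le_add_self.trans hsum)
  have r1 := ENNReal.toReal_mono (ENNReal.add_ne_top.2 ⟨ht, ENNReal.ofReal_ne_top⟩) h99
  have r2 := ENNReal.toReal_mono ENNReal.one_ne_top hsum
  have r3 := ENNReal.toReal_mono hf hfalse
  rw [ENNReal.toReal_add ht ENNReal.ofReal_ne_top, ENNReal.toReal_ofReal hη0] at r1
  rw [ENNReal.toReal_add ht hf] at r2
  simp only [ENNReal.toReal_div, ENNReal.toReal_ofNat, ENNReal.toReal_one] at r1 r2 r3
  have hexp := Real.exp_one_lt_d9
  -- The test gives `0.99 ≤ 0.01 + η`, and `0.98 - (e - 2) > 1 / 4`.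
  have hfin : 1 / 4 ≤ (2 * ε) ^ 4 * a * b / k ^ 2 * n ^ 2 := by
    norm_num at hexp
    linarith
  have h5 : (2 * ε) ^ 4 * a * b / k ^ 2 * n ^ 2 = 16 * (n ^ 2 * ε ^ 4 * (a * b)) / k ^ 2 := by
    ring
  rw [h5, le_div_iff₀ (by positivity)] at hfin
  linarith

end Testing

/-! ### Degenerate norms and the bound in extended reals -/

theorem opNorm_nonneg {k : ℕ} (A : Matrix (Fin k) (Fin k) ℝ) : 0 ≤ opNorm A := norm_nonneg _

theorem eq_zero_of_opNorm_eq_zero {k : ℕ} {A : Matrix (Fin k) (Fin k) ℝ} (h : opNorm A = 0) :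
    A = 0 :=
  (map_eq_zero_iff _ (Matrix.toEuclideanCLM (n := Fin k) (𝕜 := ℝ)).injective).1 (norm_eq_zero.1 h)

theorem le_of_existsUniformityTest {k : ℕ} [NeZero k] {Y : Type u} {𝒲 : Set (Channel k Y)}
    {ε : ℝ} (hε : 0 < ε) (hε' : ε ≤ 1 / 4) {n : ℕ}
    (hT : ExistsUniformityTest.{u, v} 𝒲 ε n) :
    ENNReal.ofReal (1 / 8) * ((k : ℝ≥0∞) / (ENNReal.ofReal ε ^ 2 *
      (familyOpNorm 𝒲 * familyNuclearNorm 𝒲) ^ (1 / 2 : ℝ))) ≤ n := by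
  obtain ⟨Ω, _, μ, _, P, T, hT⟩ := hT
  have hk : (0 : ℝ) < k := by exact_mod_cast NeZero.pos k
  have hop : ∀ W ∈ 𝒲, ENNReal.ofReal (opNorm (infoMatrix W)) ≤ familyOpNorm 𝒲 := fun W hW =>
    le_iSup₂ (f := fun W (_ : W ∈ 𝒲) => ENNReal.ofReal (opNorm (infoMatrix W))) W hW
  have hnu : ∀ W ∈ 𝒲, ENNReal.ofReal (nuclearNorm (infoMatrix W)) ≤ familyNuclearNorm 𝒲 :=
    fun W hW =>
      le_iSup₂ (f := fun W (_ : W ∈ 𝒲) => ENNReal.ofReal (nuclearNorm (infoMatrix W))) W hW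
  have hcore : ∀ a b : ℝ, 0 ≤ a → 0 ≤ b →
      (∀ W ∈ 𝒲, ∀ c : Fin k → ℝ, ∑ i, ∑ j, c i * c j * infoMatrix W i j ≤ a * ∑ i, c i ^ 2) →
      (∀ W ∈ 𝒲, (infoMatrix W).trace ≤ b) → (k : ℝ) ^ 2 ≤ 64 * (n ^ 2 * ε ^ 4 * (a * b)) :=
    fun a b ha0 hb0 ha hb => le_of_isIdentityTest P T hε hε' hT ha0 hb0 ha hb
  -- If either norm is zero, the core bound applies with `a = b = 0` and gives `k² ≤ 0`. An empty
  -- family is included.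
  have hop0 : familyOpNorm 𝒲 ≠ 0 := by
    intro h0
    have hz : ∀ W ∈ 𝒲, infoMatrix W = 0 := fun W hW => by
      have h := hop W hW
      rw [h0, nonpos_iff_eq_zero, ENNReal.ofReal_eq_zero] at h
      exact eq_zero_of_opNorm_eq_zero (le_antisymm h (opNorm_nonneg _))
    have h := hcore 0 0 le_rfl le_rfl (fun W hW c => by simp [hz W hW])
      (fun W hW => by simp [hz W hW])
    nlinarith
  have hnu0 : familyNuclearNorm 𝒲 ≠ 0 := by
    intro h0
    have hz : ∀ W ∈ 𝒲, (infoMatrix W).trace ≤ 0 := fun W hW => by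
      have h := hnu W hW
      rw [h0, nonpos_iff_eq_zero, ENNReal.ofReal_eq_zero] at h
      exact (trace_le_nuclearNorm _).trans h
    have h := hcore 0 0 le_rfl le_rfl (fun W hW c => by
      rw [zero_mul]
      exact (quadForm_infoMatrix_le_trace W c).trans
        (mul_nonpos_of_nonneg_of_nonpos (Finset.sum_nonneg fun i _ => sq_nonneg _) (hz W hW))) hz
    nlinarith
  -- Both norms being nonzero, an infinite norm makes the product infinite and the bound zero;
  -- otherwise both are finite reals.
  by_cases htop : familyOpNorm 𝒲 * familyNuclearNorm 𝒲 = ⊤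
  · rw [htop, ENNReal.top_rpow_of_pos (by norm_num), ENNReal.mul_top (by simp [hε])]
    simp
  · have hopT : familyOpNorm 𝒲 ≠ ⊤ := fun h => htop (by rw [h, ENNReal.top_mul hnu0])
    have hnuT : familyNuclearNorm 𝒲 ≠ ⊤ := fun h => htop (by rw [h, ENNReal.mul_top hop0])
    set a := (familyOpNorm 𝒲).toReal with ha
    set b := (familyNuclearNorm 𝒲).toReal with hb
    have ha0 : 0 < a := ENNReal.toReal_pos hop0 hopT
    have hb0 : 0 < b := ENNReal.toReal_pos hnu0 hnuT
    have h := hcore a b ha0.le hb0.le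
      (fun W hW c => (quadForm_le_opNorm _ c).trans (mul_le_mul_of_nonneg_right
        ((ENNReal.ofReal_le_iff_le_toReal hopT).1 (hop W hW))
        (Finset.sum_nonneg fun i _ => sq_nonneg _)))
      (fun W hW => (trace_le_nuclearNorm _).trans
        ((ENNReal.ofReal_le_iff_le_toReal hnuT).1 (hnu W hW)))
    have hab : 0 < √(a * b) := Real.sqrt_pos.2 (mul_pos ha0 hb0)
    have hreal : 1 / 8 * (k / (ε ^ 2 * √(a * b))) ≤ n := by
      have hle : (k : ℝ) ≤ 8 * (n * ε ^ 2 * √(a * b)) := by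
        refine le_of_sq_le_sq (h.trans (le_of_eq ?_)) (by positivity)
        rw [mul_pow, mul_pow, Real.sq_sqrt (by positivity)]
        ring
      rw [← mul_div_assoc, div_le_iff₀ (by positivity)]
      linarith
    have hprod : familyOpNorm 𝒲 * familyNuclearNorm 𝒲 = ENNReal.ofReal (a * b) := by
      rw [ENNReal.ofReal_mul ha0.le, ENNReal.ofReal_toReal hopT, ENNReal.ofReal_toReal hnuT]
    rw [hprod, ENNReal.ofReal_rpow_of_pos (mul_pos ha0 hb0), ← Real.sqrt_eq_rpow,
      ← ENNReal.ofReal_pow hε.le, ← ENNReal.ofReal_mul (by positivity),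
      ← ENNReal.ofReal_natCast k, ← ENNReal.ofReal_div_of_pos (by positivity),
      ← ENNReal.ofReal_mul (by norm_num), ← ENNReal.ofReal_natCast n]
    exact ENNReal.ofReal_le_ofReal hreal

end InteractiveTesting

end

theorem mainTheorem2 :
    ∃ c : ℝ, 0 < c ∧
      ∀ (k : ℕ) [NeZero k] (Y : Type u) [Countable Y]
        (𝒲 : Set (InteractiveTesting.Channel k Y)) (ε : ℝ), 0 < ε → ε ≤ 1 / 4 →
        ENNReal.ofReal c * ((k : ℝ≥0∞) /
            (ENNReal.ofReal ε ^ 2 *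
              (InteractiveTesting.familyOpNorm 𝒲 *
                InteractiveTesting.familyNuclearNorm 𝒲) ^ (1 / 2 : ℝ))) ≤
          ((InteractiveTesting.sampleComplexity.{u, v} 𝒲 ε : ℕ∞) : ℝ≥0∞) := by
  refine ⟨1 / 8, by norm_num, fun k _ Y _ 𝒲 ε hε hε' => ?_⟩
  by_cases htop : InteractiveTesting.sampleComplexity.{u, v} 𝒲 ε = ⊤
  · rw [htop]
    simp
  · have hlt := (ENat.lt_add_one_iff htop).2 le_rfl
    obtain ⟨n, hn⟩ := iInf_lt_iff.1 (show ⨅ (n : ℕ) (_ :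
      InteractiveTesting.ExistsUniformityTest.{u, v} 𝒲 ε n), (n : ℕ∞) < _ from hlt)
    obtain ⟨hT, hn⟩ := iInf_lt_iff.1 hn
    refine (InteractiveTesting.le_of_existsUniformityTest hε hε' hT).trans ?_
    have h2 := ENat.toENNReal_le.2 ((ENat.lt_add_one_iff htop).1 hn)
    simpa using h2
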